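/- Let $\mathfrak g$ be of type $\mathsf B_n$ $(n\ge 2)$, $\mathsf C_n$ $(n\ge 3)$ or $\mathsf D_n$ $(n\ge 4)$. Let $\varepsilon_1,\dots,\varepsilon_n$ be the usual orthonormal basis, with $(\varepsilon_i,\varepsilon_j)=\delta_{ij}$, and put $\varepsilon_{-a}:=-\varepsilon_a$ and $\varepsilon_0:=0$. The positive roots are $\varepsilon_i\pm\varepsilon_j$ $(i<j)$, together with all $\varepsilon_i$ in type $\mathsf B_n$ and all $2\varepsilon_i$ in type $\mathsf C_n$. Let $\rho$ be their half sum and $P$ the weight lattice. Let $m_o$ be the least positive integer with $m_o(\lambda,\mu)\in\mathbb Z$ for all $\lambda,\mu\in P$, let $\mathbb K=\mathbb C(\hat q)$ with $\hat q$ an indeterminate, $q=\hat q^{\,m_o}$, and $q^{x}:=\hat q^{\,m_o x}$ whenever $m_ox\in\mathbb Z$. Let $\mathrm U^0$ be the Cartan part of $\mathrm U_q(\mathfrak g)$, that is, the commutative $\mathbb K$-algebra with basis $K_\lambda$ $(\lambda\in P)$ and $K_\lambda K_\mu=K_{\lambda+\mu}$, $K_0=1$ (a domain), and let $L_a:=q^{(\varepsilon_a,2\rho)}K_{2\varepsilon_a}\in\mathrm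 U^0$. Put $\mathbf I_n=\{-n,\dots,-1,1,\dots,n\}$. Let $\mathbf I'_n=\mathbf I_n\cup\{0\}$ and $c_n=2n$ in type $\mathsf B_n$; $\mathbf I'_n=\mathbf I_n$ and $c_n=2n+1$ in type $\mathsf C_n$; $\mathbf I'_n=\mathbf I_n$ and $c_n=2n-1$ in type $\mathsf D_n$. For $a\in\mathbf I_n$ let $$P_{n,a}=\prod_{b\in\mathbf I_n\setminus\{\pm a\}}\frac{qL_a-q^{-1}L_b}{L_a-L_b},$$ and for $k\ge 0$ define, in the field of fractions of $\mathrm U^0$, \begin{align*} \text{type }\mathsf B_n:\quad G_{n,k}&=q^{-k}+\sum_{a\in\mathbf I_n}\frac{qL_a-q^{-1}L_a^{-1}+q-q^{-1}}{L_a-L_a^{-1}}\,L_a^k\,P_{n,a},\\ \text{type }\mathsf C_n:\quad G_{n,k}&=\sum_{a\in\mathbf I_n}\frac{q^2L_a-q^{-2}L_a^{-1}}{L_a-L_a^{-1}}\,L_a^k\,P_{n,a},\\ \text{type }\mathsf D_n:\quad G_{n,k}&=\sum_{a\in\mathbf I_n}L_a^k\,P_{n,a}. \end{align*} Then in each of these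 types $$G_{n,0}=\sum_{a\in\mathbf I'_n}q^{(2\rho,\varepsilon_a)},\qquad G_{n,1}=q^{c_n-1}\sum_{a\in\mathbf I'_n}L_a .$$ -/

import Mathlib

namespace QuantumCasimir

/-- The three families of classical types under consideration. -/
inductive ClassicalType
  | B
  | C
  | D

/-- The smallest rank considered in each type: `B_n` for `n ≥ 2`, `C_n` for `n ≥ 3` and
`D_n` for `n ≥ 4`. -/
def ClassicalType.minRank : ClassicalType → ℕ
  | .B => 2
  | .C => 3
  | .D => 4

/-- The rational form of `𝔥^*`, with coordinates in the orthonormal basis `ε_1, …, ε_n`.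
The form `(·,·)` with `(ε_i, ε_j) = δ_{ij}` is the dot product `⬝ᵥ`. -/
abbrev Vec (n : ℕ) : Type := Fin n → ℚ

/-- The vectors `ε_a` for `-n ≤ a ≤ n`: the standard basis for `a > 0`, together with
`ε_{-a} = -ε_a` and `ε_0 = 0`. (The coordinate `i : Fin n` is number `i + 1`.) -/
def eps (n : ℕ) (a : ℤ) : Vec n := fun i =>
  if a = (i : ℤ) + 1 then 1 else if a = -((i : ℤ) + 1) then -1 else 0

/-- The simple roots `α_i`, for `1 ≤ i ≤ n`. -/
def simpleRoot (X : ClassicalType) (n i : ℕ) : Vec n :=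
  if i < n then eps n i - eps n (i + 1)
  else match X with
    | .B => eps n n
    | .C => (2 : ℚ) • eps n n
    | .D => eps n (n - 1) + eps n n

/-- The half sum `ρ` of the positive roots. The positive roots are `ε_i ± ε_j` for `i < j`,
together with all `ε_i` in type `B` and all `2 ε_i` in type `C`. -/
def rho (X : ClassicalType) (n : ℕ) : Vec n :=
  (1 / 2 : ℚ) •
    ((∑ i ∈ Finset.Icc 1 n, ∑ j ∈ Finset.Ioc i n,
        ((eps n i - eps n j) + (eps n i + eps n j))) +
      match X with
        | .B => ∑ i ∈ Finset.Icc 1 n, eps n i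
        | .C => ∑ i ∈ Finset.Icc 1 n, (2 : ℚ) • eps n i
        | .D => 0)

/-- The weight lattice `P`: the vectors `λ` with `2 (λ, α_i) / (α_i, α_i) ∈ ℤ` for every simple
root `α_i`, that is, the integral combinations of the fundamental weights. -/
def weightLattice (X : ClassicalType) (n : ℕ) : AddSubgroup (Vec n) where
  carrier := {v | ∀ i : ℕ, 1 ≤ i → i ≤ n →
    ∃ z : ℤ, 2 * (v ⬝ᵥ simpleRoot X n i) / (simpleRoot X n i ⬝ᵥ simpleRoot X n i) = z}
  zero_mem' := fun i _ _ => ⟨0, by simp⟩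
  add_mem' := by
    intro v w hv hw i h1 h2
    obtain ⟨y, hy⟩ := hv i h1 h2
    obtain ⟨z, hz⟩ := hw i h1 h2
    refine ⟨y + z, ?_⟩
    rw [add_dotProduct, mul_add, add_div, hy, hz]
    push_cast
    rfl
  neg_mem' := by
    intro v hv i h1 h2
    obtain ⟨z, hz⟩ := hv i h1 h2
    refine ⟨-z, ?_⟩
    rw [neg_dotProduct, mul_neg, neg_div, hz]
    push_cast
    rfl

/-- The least positive integer `m` such that `(λ, μ) m ∈ ℤ` for all `λ, μ ∈ P`. -/
noncomputable def mo (X : ClassicalType) (n : ℕ) : ℕ :=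
  sInf {m : ℕ | 0 < m ∧ ∀ v ∈ weightLattice X n, ∀ w ∈ weightLattice X n,
    ∃ z : ℤ, (v ⬝ᵥ w) * (m : ℚ) = z}

/-- The ground field `𝕂 = ℂ(q̂)`, rational functions in the indeterminate `q̂ = q^{1/mo}`. -/
abbrev 𝕂 : Type := RatFunc ℂ

/-- The power `q^x := q̂^{x mo}` for a rational number `x` with `x mo ∈ ℤ`, for instance for
`x = (λ, μ)` with `λ, μ ∈ P`. (The floor only serves to read the integer `x mo` as an element
of `ℤ`.) -/
noncomputable def qPow (X : ClassicalType) (n : ℕ) (x : ℚ) : 𝕂 :=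
  (RatFunc.X : 𝕂) ^ ⌊x * (mo X n : ℚ)⌋

/-- The element `q = q̂^{mo}` of `𝕂`. -/
noncomputable def q (X : ClassicalType) (n : ℕ) : 𝕂 := (RatFunc.X : 𝕂) ^ mo X n

/-- The algebra `U^0`, with `𝕂`-basis the elements `K_λ` for `λ ∈ P`, and with `K_0 = 1`,
`K_λ K_μ = K_{λ + μ}`: the group algebra of `P`. -/
abbrev U0 (X : ClassicalType) (n : ℕ) : Type := AddMonoidAlgebra 𝕂 (weightLattice X n)

/-- The basis element `K_λ` of `U^0`. -/
noncomputable def Kel (X : ClassicalType) (n : ℕ) (v : weightLattice X n) : U0 X n :=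
  AddMonoidAlgebra.single v 1

instance (X : ClassicalType) (n : ℕ) : UniqueSums (weightLattice X n) :=
  UniqueSums.of_injective_addHom ((weightLattice X n).subtype : _ →ₙ+ Vec n)
    Subtype.val_injective inferInstance

instance (X : ClassicalType) (n : ℕ) : IsDomain (U0 X n) := inferInstance

/-- The field of fractions of `U^0`. -/
abbrev FracU0 (X : ClassicalType) (n : ℕ) : Type := FractionRing (U0 X n)

theorem dot_eps {n : ℕ} (v : Vec n) (b : ℕ) (h1 : 1 ≤ b) (h2 : b ≤ n) :
    v ⬝ᵥ eps n b = v ⟨b - 1, by omega⟩ := by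
  rw [dotProduct, Finset.sum_eq_single (⟨b - 1, by omega⟩ : Fin n)]
  · have h : (b : ℤ) = ((b - 1 : ℕ) : ℤ) + 1 := by omega
    simp [eps, h]
  · intro i _ hi
    have hne : (i : ℕ) ≠ b - 1 := fun h => hi (Fin.ext h)
    have h3 : ¬ ((b : ℤ) = (i : ℤ) + 1) := by omega
    have h4 : ¬ ((b : ℤ) = -((i : ℤ) + 1)) := by omega
    simp only [eps, if_neg h3, if_neg h4, mul_zero]
  · intro h
    exact absurd (Finset.mem_univ _) h

theorem eps_int (n : ℕ) (a : ℤ) (i : Fin n) : ∃ z : ℤ, eps n a i = z := by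
  unfold eps
  split_ifs
  · exact ⟨1, by simp⟩
  · exact ⟨-1, by simp⟩
  · exact ⟨0, by simp⟩

/-- The vectors `ε_a` are weights. -/
theorem eps_mem (X : ClassicalType) (n : ℕ) (a : ℤ) : eps n a ∈ weightLattice X n := by
  intro i h1 h2
  obtain ⟨y, hy⟩ := eps_int n a ⟨i - 1, by omega⟩
  have hself : ∀ b : ℕ, 1 ≤ b → b ≤ n → eps n b ⬝ᵥ eps n b = 1 := by
    intro b hb1 hb2
    rw [dot_eps _ b hb1 hb2]
    have h : (b : ℤ) = ((b - 1 : ℕ) : ℤ) + 1 := by omega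
    simp [eps, h]
  have hother : ∀ b d : ℕ, 1 ≤ b → b ≤ n → 1 ≤ d → b ≠ d → eps n d ⬝ᵥ eps n b = 0 := by
    intro b d hb1 hb2 hd1 hbd
    rw [dot_eps _ b hb1 hb2]
    have h3 : ¬ ((d : ℤ) = ((b - 1 : ℕ) : ℤ) + 1) := by omega
    have h4 : ¬ ((d : ℤ) = -(((b - 1 : ℕ) : ℤ) + 1)) := by omega
    simp only [eps, if_neg h3, if_neg h4]
  have hi := hself i h1 h2
  have hd : eps n a ⬝ᵥ eps n i = y := by rw [dot_eps _ i h1 h2, hy]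
  unfold simpleRoot
  split_ifs with hin
  · have e : ((i : ℤ) + 1) = ((i + 1 : ℕ) : ℤ) := by push_cast; rfl
    rw [e]
    obtain ⟨z, hz⟩ := eps_int n a ⟨i + 1 - 1, by omega⟩
    refine ⟨y - z, ?_⟩
    have hd' : eps n a ⬝ᵥ eps n ((i + 1 : ℕ) : ℤ) = z := by
      rw [dot_eps _ (i + 1) (by omega) hin, hz]
    simp only [dotProduct_sub, sub_dotProduct, hd, hd', hi,
      hself (i + 1) (by omega) hin, hother i (i + 1) h1 h2 (by omega) (by omega),
      hother (i + 1) i (by omega) hin h1 (by omega)]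
    push_cast
    ring
  · obtain rfl : i = n := by omega
    cases X with
    | B => exact ⟨2 * y, by simp only [hd, hi]; push_cast; ring⟩
    | C =>
      refine ⟨y, ?_⟩
      simp only [dotProduct_smul, smul_dotProduct, hd, hi, smul_eq_mul]
      ring
    | D =>
      have e : ((i : ℤ) - 1) = ((i - 1 : ℕ) : ℤ) := by omega
      simp only [e]
      by_cases h : i = 1
      · subst h
        have h0 : eps 1 ((1 - 1 : ℕ) : ℤ) = 0 := by
          funext j
          fin_cases j
          simp [eps]
        exact ⟨2 * y, by rw [h0]; simp only [zero_add, hd, hi]; push_cast; ring⟩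
      · obtain ⟨z, hz⟩ := eps_int i a ⟨i - 1 - 1, by omega⟩
        refine ⟨y + z, ?_⟩
        have hd' : eps i a ⬝ᵥ eps i ((i - 1 : ℕ) : ℤ) = z := by
          rw [dot_eps _ (i - 1) (by omega) (by omega), hz]
        simp only [dotProduct_add, add_dotProduct, hd, hd', hi,
          hself (i - 1) (by omega) (by omega), hother i (i - 1) h1 h2 (by omega) (by omega),
          hother (i - 1) i (by omega) (by omega) h1 (by omega)]
        push_cast
        ring

/-- The weight `ε_a ∈ P`. -/
def epsP (X : ClassicalType) (n : ℕ) (a : ℤ) : weightLattice X n := ⟨eps n a, eps_mem X n a⟩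

/-- The index set `I_n = {-n, …, -1, 1, …, n}`. -/
noncomputable def I (n : ℕ) : Finset ℤ := (Finset.Icc (-(n : ℤ)) n).erase 0

/-- The index set `I'_n`, which is `I_n ∪ {0}` in type `B` and `I_n` in types `C` and `D`. -/
noncomputable def I' (X : ClassicalType) (n : ℕ) : Finset ℤ :=
  match X with
  | .B => insert 0 (I n)
  | .C => I n
  | .D => I n

/-- The integer `c_n`. -/
def c (X : ClassicalType) (n : ℕ) : ℤ :=
  match X with
  | .B => 2 * n
  | .C => 2 * n + 1
  | .D => 2 * n - 1

/-- The element `L_a = q^{(ε_a, 2ρ)} K_{2 ε_a}` of `U^0`. -/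
noncomputable def L (X : ClassicalType) (n : ℕ) (a : ℤ) : U0 X n :=
  qPow X n (eps n a ⬝ᵥ (2 : ℚ) • rho X n) • Kel X n (2 • epsP X n a)

/-- The element `L_a` viewed in the field of fractions of `U^0`. -/
noncomputable def Lf (X : ClassicalType) (n : ℕ) (a : ℤ) : FracU0 X n :=
  algebraMap (U0 X n) (FracU0 X n) (L X n a)

/-- The element `q` viewed in the field of fractions of `U^0`. -/
noncomputable def qf (X : ClassicalType) (n : ℕ) : FracU0 X n :=
  algebraMap 𝕂 (FracU0 X n) (q X n)

/-- The product `P_{n,a} = ∏_{b ∈ I_n ∖ {±a}} (q L_a - q⁻¹ L_b) / (L_a - L_b)`. -/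
noncomputable def Pna (X : ClassicalType) (n : ℕ) (a : ℤ) : FracU0 X n :=
  ∏ b ∈ I n \ {a, -a},
    (qf X n * Lf X n a - (qf X n)⁻¹ * Lf X n b) / (Lf X n a - Lf X n b)

/-- The elements `G_{n,k}`, for `k ≥ 0`. -/
noncomputable def G : (X : ClassicalType) → (n k : ℕ) → FracU0 X n
  | .B, n, k =>
    let q' := qf .B n
    let L' := Lf .B n
    (q' ^ k)⁻¹ + ∑ a ∈ I n,
      (q' * L' a - q'⁻¹ * (L' a)⁻¹ + q' - q'⁻¹) / (L' a - (L' a)⁻¹) * L' a ^ k * Pna .B n a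
  | .C, n, k =>
    let q' := qf .C n
    let L' := Lf .C n
    ∑ a ∈ I n,
      (q' ^ 2 * L' a - (q' ^ 2)⁻¹ * (L' a)⁻¹) / (L' a - (L' a)⁻¹) * L' a ^ k * Pna .C n a
  | .D, n, k => ∑ a ∈ I n, Lf .D n a ^ k * Pna .D n a

end QuantumCasimir

namespace QuantumCasimir

/-! Write x_a = L_a, so that x_{-a} = x_a⁻¹, and y_j = x_j + x_j⁻¹. Pairing b with -b, the numerator
of P_{n,a} becomes ∏_{j ≠ |a|} (u z² - y_j z + v) at z = x_a, with u = q² and v = q⁻². The omitted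
index depends on a, but one polynomial Q has all these values: formally Q = (V - E) / ((u-1)X² +
(v-1)) with V = ∏ (uX² - y_j X + v) and E = ∏ (X² - y_j X + 1). The division is exact because
corresponding factors of V and E differ by the same divisor for every j.

Restoring the factor b = -a gives P_{n,a} = Q(x_a)(x_a - x_a⁻¹) / ∏_{b ≠ a} (x_a - x_b), which
cancels the denominator x_a - x_a⁻¹ of the summand. In all three types G_{n,k} is thus, up to the
extra q^{-k} in type B, a Lagrange sum of p(x_a) x_a^{k-1} / ∏_{b ≠ a} (x_a - x_b) with p = (αX² +
βX + γ)Q. Such a sum depends only on the extreme coefficients of p, which are geometric sums in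
q^{±2} and, for the subleading one, a multiple of ∑ x_a. See `exists_interpolating_poly`,
`casimir_sum_zero` and `casimir_sum_one`. -/

/-! ### The interpolating polynomial Q -/

open Polynomial in
/-- The polynomial `∏_{i ∈ s} (u X² - y_i X + v)` has the expected extreme coefficients. -/
theorem coeff_prod_quadratic {F ι : Type*} [Field F] [DecidableEq ι] (u v : F) (y : ι → F)
    (s : Finset ι) :
    (∏ i ∈ s, (C u * X ^ 2 - C (y i) * X + C v)).natDegree ≤ 2 * s.card ∧
    (∏ i ∈ s, (C u * X ^ 2 - C (y i) * X + C v)).coeff (2 * s.card) = u ^ s.card ∧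
    (X * ∏ i ∈ s, (C u * X ^ 2 - C (y i) * X + C v)).coeff (2 * s.card) * u =
      -(∑ i ∈ s, y i) * u ^ s.card ∧
    (∏ i ∈ s, (C u * X ^ 2 - C (y i) * X + C v)).coeff 0 = v ^ s.card := by
  induction s using Finset.induction_on with
  | empty => simp
  | insert j s hj ih =>
    rw [Finset.prod_insert hj, Finset.sum_insert hj, Finset.card_insert_of_notMem hj]
    set V := ∏ i ∈ s, (C u * X ^ 2 - C (y i) * X + C v)
    obtain ⟨h1, h2, h3, h4⟩ := ih
    have e : (C u * X ^ 2 - C (y j) * X + C v) * V =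
        C u * (V * X ^ 2) - C (y j) * (V * X) + C v * V := by ring
    have e' : X * (C u * (V * X ^ 2) - C (y j) * (V * X) + C v * V) =
        C u * (X * V * X ^ 2) - C (y j) * (V * X ^ 2) + C v * (V * X) := by ring
    have z1 : V.coeff (2 * s.card + 1) = 0 := coeff_eq_zero_of_natDegree_lt (by omega)
    have z2 : V.coeff (2 * s.card + 2) = 0 := coeff_eq_zero_of_natDegree_lt (by omega)
    refine ⟨?_, ?_, ?_, ?_⟩
    · have : (C u * X ^ 2 - C (y j) * X + C v).natDegree ≤ 2 := by compute_degree
      exact (natDegree_mul_le).trans (by omega)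
    · rw [e, mul_add, mul_one, coeff_add, coeff_sub, coeff_C_mul, coeff_C_mul, coeff_C_mul,
        coeff_mul_X_pow, coeff_mul_X, h2, z1, z2]
      ring
    · rw [e, e', mul_add, mul_one, coeff_add, coeff_sub, coeff_C_mul, coeff_C_mul, coeff_C_mul,
        coeff_mul_X_pow, coeff_mul_X_pow, coeff_mul_X, h2, z1]
      linear_combination u * h3
    · rw [mul_coeff_zero, h4]
      simp only [coeff_add, coeff_sub, coeff_C_mul, coeff_X_pow, coeff_X_zero, coeff_C_zero]
      simp [pow_succ']

open Polynomial in
/-- A polynomial interpolating `z ↦ ∏_{j ≠ i} (u z² - y_j z + v)` at the roots `z` of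
`X² - y_i X + 1`, for every `i`, with its extreme coefficients. -/
theorem exists_interpolating_poly {F ι : Type*} [Field F] [DecidableEq ι] (u v : F) (y : ι → F)
    (s : Finset ι) :
    ∃ Q : F[X], (∀ i ∈ s, ∀ z : F, z ^ 2 - y i * z + 1 = 0 →
        Q.eval z = ∏ j ∈ s.erase i, (u * z ^ 2 - y j * z + v)) ∧
      (X ^ 2 * Q).natDegree ≤ 2 * s.card ∧
      (X ^ 2 * Q).coeff (2 * s.card) = ∑ i ∈ Finset.range s.card, u ^ i ∧
      u * (X ^ 3 * Q).coeff (2 * s.card) =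
        -(∑ i ∈ s, y i) * (∑ i ∈ Finset.range s.card, u ^ i - 1) ∧
      Q.coeff 0 = ∑ i ∈ Finset.range s.card, v ^ i := by
  induction s using Finset.induction_on with
  | empty => exact ⟨0, by simp⟩
  | insert j s hj ih =>
    obtain ⟨Q, h0, h1, h2, h3, h4⟩ := ih
    obtain ⟨g1, g2, g3, g4⟩ := coeff_prod_quadratic u v y s
    rw [Finset.sum_insert hj, Finset.card_insert_of_notMem hj]
    set V := ∏ i ∈ s, (C u * X ^ 2 - C (y i) * X + C v) with hV
    have ev : ∀ z, V.eval z = ∏ i ∈ s, (u * z ^ 2 - y i * z + v) := by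
      intro z
      rw [hV, eval_prod]
      simp
    -- Q has degree at most 2|s| - 2. The factors X² and X³ bring its top two coefficients to
    -- position 2|s|, so that no index is a truncated subtraction, even for s empty.
    have e : X ^ 2 * ((X ^ 2 - C (y j) * X + 1) * Q + V) =
      (X ^ 2 * Q - C (y j) * (Q * X) + Q + V) * X ^ 2 := by ring
    have e' : X ^ 3 * ((X ^ 2 - C (y j) * X + 1) * Q + V) =
      (X ^ 3 * Q - C (y j) * (X ^ 2 * Q) + X * Q + X * V) * X ^ 2 := by ring
    have zz : ∀ k, 2 * s.card < k + 2 → Q.coeff k = 0 := by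
      intro k hk
      have := coeff_eq_zero_of_natDegree_lt (lt_of_le_of_lt h1 hk)
      rwa [coeff_X_pow_mul] at this
    have z1 : (Q * X).coeff (2 * s.card) = 0 := by
      rcases Nat.eq_zero_or_pos s.card with h | h
      · simp [h]
      · obtain ⟨m, hm⟩ : ∃ m, 2 * s.card = m + 1 := ⟨2 * s.card - 1, by omega⟩
        rw [hm, coeff_mul_X]
        exact zz _ (by omega)
    have gs := geom_sum_succ (x := u) (n := s.card)
    have gs' := geom_sum_succ' (x := u) (n := s.card)
    -- Telescoping of (V - E) / ((u-1)X² + (v-1)) when j is added; building Q this way involves no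
    -- division, so u = 1 is allowed.
    refine ⟨(X ^ 2 - C (y j) * X + 1) * Q + V, ?_, ?_, ?_, ?_, ?_⟩
    · intro i hi z hz
      rw [eval_add, eval_mul, ev]
      simp only [eval_add, eval_sub, eval_mul, eval_pow, eval_X, eval_C, eval_one]
      rcases Finset.mem_insert.1 hi with rfl | his
      · rw [hz, Finset.erase_insert hj]
        ring
      · have hij : i ≠ j := fun h => hj (h ▸ his)
        rw [h0 i his z hz, Finset.erase_insert_of_ne hij.symm, Finset.prod_insert (by simp [hj]),
          ← Finset.mul_prod_erase s _ his]
        -- V contributes the factor u z² - y_i z + v, and its sum with z² - y_j z + 1 is u z² - y_j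
        -- z + v plus the vanishing z² - y_i z + 1.
        linear_combination (∏ k ∈ s.erase i, (u * z ^ 2 - y k * z + v)) * hz
    · rw [e]
      refine natDegree_le_iff_coeff_eq_zero.2 fun k hk => ?_
      obtain ⟨m, rfl⟩ : ∃ m, k = m + 1 + 2 := ⟨k - 3, by omega⟩
      rw [coeff_mul_X_pow, coeff_add, coeff_add, coeff_sub, coeff_C_mul, coeff_mul_X,
        coeff_eq_zero_of_natDegree_lt (lt_of_le_of_lt h1 (by omega)), zz _ (by omega),
        zz _ (by omega), coeff_eq_zero_of_natDegree_lt (lt_of_le_of_lt g1 (by omega))]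
      ring
    · rw [e, mul_add, mul_one, coeff_mul_X_pow, coeff_add, coeff_add, coeff_sub, coeff_C_mul, z1,
        zz _ (by omega), g2, h2, gs']
      ring
    · rw [e', mul_add, mul_one, coeff_mul_X_pow, coeff_add, coeff_add, coeff_sub, coeff_C_mul,
        mul_comm X Q, z1, h2, gs']
      rw [gs'] at gs
      linear_combination h3 + g3 + y j * gs
    · rw [coeff_add, mul_coeff_zero, h4, g4, geom_sum_succ']
      simp [add_comm]

/-! ### Lagrange sums as coefficients -/

open Polynomial in
theorem sum_eval_div_eq_coeff {F ι : Type*} [Field F] [DecidableEq ι] {s : Finset ι} {x : ι → F}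
    (hx : Set.InjOn x s) {p : F[X]} {m : ℕ} (hm : s.card = m + 1) (hp : p.natDegree ≤ m) :
    ∑ a ∈ s, p.eval (x a) / ∏ b ∈ s.erase a, (x a - x b) = p.coeff m := by
  have h : p.degree < s.card := by
    rw [hm]
    exact lt_of_le_of_lt (natDegree_le_iff_degree_le.1 hp) (by exact_mod_cast Nat.lt_succ_self m)
  rw [← Lagrange.coeff_eq_sum hx h, hm, Nat.add_sub_cancel]

open Polynomial in
-- Subtracting `p.coeff (m + 1)` times the nodal polynomial E lowers the degree without changing the
-- values at the nodes; the next coefficient of E is -∑ x_a.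
theorem sum_eval_div_eq_coeff_add {F ι : Type*} [Field F] [DecidableEq ι] {s : Finset ι}
    {x : ι → F} (hx : Set.InjOn x s) {p : F[X]} {m : ℕ} (hm : s.card = m + 1)
    (hp : p.natDegree ≤ m + 1) :
    ∑ a ∈ s, p.eval (x a) / ∏ b ∈ s.erase a, (x a - x b) =
      p.coeff m + p.coeff (m + 1) * ∑ a ∈ s, x a := by
  set E := ∏ b ∈ s, (X - C (x b)) with hE
  have hEd : E.natDegree = m + 1 := by rw [hE, natDegree_finsetProd_X_sub_C_eq_card, hm]
  have hEm : E.coeff (m + 1) = 1 := hEd ▸ monic_prod_X_sub_C x s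
  have hEc : E.coeff m = -∑ a ∈ s, x a := by
    have := prod_X_sub_C_coeff_card_pred s x (by omega)
    rwa [hm, Nat.add_sub_cancel] at this
  have key := sum_eval_div_eq_coeff hx hm (p := p - C (p.coeff (m + 1)) * E) (by
    refine natDegree_le_iff_coeff_eq_zero.2 fun k hk => ?_
    rw [coeff_sub, coeff_C_mul]
    rcases (Nat.succ_le_of_lt hk).eq_or_lt with h | h
    · subst h
      rw [hEm]
      ring
    · rw [coeff_eq_zero_of_natDegree_lt (p := p) (by omega),
        coeff_eq_zero_of_natDegree_lt (p := E) (by omega)]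
      ring)
  rw [coeff_sub, coeff_C_mul, hEc] at key
  rw [show p.coeff m + p.coeff (m + 1) * ∑ a ∈ s, x a =
    p.coeff m - p.coeff (m + 1) * -∑ a ∈ s, x a by ring, ← key]
  refine Finset.sum_congr rfl fun a ha => ?_
  have : E.eval (x a) = 0 := by
    rw [hE, eval_prod]
    exact Finset.prod_eq_zero ha (by simp)
  rw [eval_sub, eval_mul, this, mul_zero, sub_zero]

open Polynomial in
-- Since E(0) = 1, the polynomial p - p(0)E is divisible by X and agrees with p at the nodes; the
-- previous Lagrange formula applies to the quotient. The term -p(0) is the residue at 0.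
theorem sum_eval_mul_inv_div_eq_coeff_sub {F ι : Type*} [Field F] [DecidableEq ι] {s : Finset ι}
    {x : ι → F} (hx : Set.InjOn x s) (hx0 : ∀ a ∈ s, x a ≠ 0) (hx1 : ∏ a ∈ s, -x a = 1)
    {p : F[X]} {m : ℕ} (hm : s.card = m + 1) (hp : p.natDegree ≤ m + 1) :
    ∑ a ∈ s, p.eval (x a) * (x a)⁻¹ / ∏ b ∈ s.erase a, (x a - x b) =
      p.coeff (m + 1) - p.coeff 0 := by
  set E := ∏ b ∈ s, (X - C (x b)) with hE
  have hEd : E.natDegree = m + 1 := by rw [hE, natDegree_finsetProd_X_sub_C_eq_card, hm]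
  have hEm : E.coeff (m + 1) = 1 := hEd ▸ monic_prod_X_sub_C x s
  have hE0 : E.coeff 0 = 1 := by rw [coeff_zero_eq_eval_zero, hE, eval_prod, ← hx1]; simp
  have hr : (p - C (p.coeff 0) * E).coeff 0 = 0 := by rw [coeff_sub, coeff_C_mul, hE0]; ring
  obtain ⟨r, hr⟩ := X_dvd_iff.2 hr
  have hrc : ∀ k, r.coeff k = p.coeff (k + 1) - p.coeff 0 * E.coeff (k + 1) := by
    intro k
    rw [← coeff_X_mul, ← hr, coeff_sub, coeff_C_mul]
  have key := sum_eval_div_eq_coeff hx hm (p := r) (by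
    refine natDegree_le_iff_coeff_eq_zero.2 fun k hk => ?_
    rw [hrc, coeff_eq_zero_of_natDegree_lt (p := p) (by omega),
        coeff_eq_zero_of_natDegree_lt (p := E) (by omega)]
    ring)
  rw [hrc, hEm, mul_one] at key
  rw [← key]
  refine Finset.sum_congr rfl fun a ha => ?_
  have h0 : E.eval (x a) = 0 := by
    rw [hE, eval_prod]
    exact Finset.prod_eq_zero ha (by simp)
  have h1 : p.eval (x a) = x a * r.eval (x a) := by
    have := congrArg (eval (x a)) hr
    rwa [eval_sub, eval_mul, h0, mul_zero, sub_zero, eval_mul, eval_X] at this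
  rw [h1, mul_comm (x a), mul_inv_cancel_right₀ (hx0 a ha)]

/-! ### The signed index set -/

theorem mem_I {n : ℕ} {a : ℤ} : a ∈ I n ↔ a ≠ 0 ∧ -(n : ℤ) ≤ a ∧ a ≤ n := by
  simp [I]

theorem prod_I {M : Type*} [CommMonoid M] (n : ℕ) (f : ℤ → M) :
    ∏ b ∈ I n, f b = ∏ j ∈ Finset.Icc (1 : ℤ) n, f j * f (-j) := by
  have h : I n = Finset.Icc (1 : ℤ) n ∪ (Finset.Icc (1 : ℤ) n).image Neg.neg := by
    ext a
    simp only [mem_I, Finset.mem_union, Finset.mem_image, Finset.mem_Icc]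
    constructor
    · intro h
      rcases lt_or_ge a 0 with h' | h'
      · exact Or.inr ⟨-a, by omega, by omega⟩
      · exact Or.inl (by omega)
    · rintro (h | ⟨b, h, rfl⟩) <;> omega
  rw [h, Finset.prod_union, Finset.prod_image (by simp), Finset.prod_mul_distrib]
  rw [Finset.disjoint_left]
  intro a ha hb
  simp only [Finset.mem_image, Finset.mem_Icc] at ha hb
  obtain ⟨b, hb, rfl⟩ := hb
  omega

theorem prod_I_sdiff {M : Type*} [CommMonoid M] {n : ℕ} {a : ℤ} (f : ℤ → M) :
    ∏ b ∈ I n \ {a, -a}, f b = ∏ j ∈ (Finset.Icc (1 : ℤ) n).erase |a|, f j * f (-j) := by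
  rw [Finset.sdiff_eq_filter, Finset.prod_filter, prod_I, ← Finset.filter_ne', Finset.prod_filter]
  refine Finset.prod_congr rfl fun j hj => ?_
  have hj := Finset.mem_Icc.1 hj
  have habs := abs_cases a
  by_cases h : j = |a|
  · have h1 : ¬¬(j = a ∨ j = -a) := by omega
    have h2 : ¬¬(-j = a ∨ -j = -a) := by omega
    simp only [Finset.mem_insert, Finset.mem_singleton, if_neg h1, if_neg h2, if_neg (not_not.2 h),
      mul_one, ne_eq]
  · have h1 : ¬(j = a ∨ j = -a) := by omega
    have h2 : ¬(-j = a ∨ -j = -a) := by omega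
    simp only [Finset.mem_insert, Finset.mem_singleton, if_pos h1, if_pos h2, if_pos h, ne_eq]

theorem sum_I {M : Type*} [AddCommMonoid M] (n : ℕ) (f : ℤ → M) :
    ∑ b ∈ I n, f b = ∑ j ∈ Finset.Icc (1 : ℤ) n, (f j + f (-j)) :=
  prod_I (M := Multiplicative M) n f

theorem card_I (n : ℕ) : (I n).card = 2 * n := by
  rw [Finset.card_eq_sum_ones, sum_I]
  simp
  omega

theorem sub_inv_ne_zero_of_injOn {F : Type*} [Field F] {n : ℕ} {x : ℤ → F}
    (hx : Set.InjOn x (I n)) (hxn : ∀ a, x (-a) = (x a)⁻¹) {a : ℤ} (ha : a ∈ I n) :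
    x a - (x a)⁻¹ ≠ 0 := by
  have ha' := mem_I.1 ha
  rw [← hxn, sub_ne_zero]
  intro h
  have := hx ha (mem_I.2 (by omega)) h
  omega

/-! ### The sums for arbitrary nodes with x_{-a} = x_a⁻¹ -/

open Polynomial in
theorem exists_poly_eval_eq_prod {F : Type*} [Field F] {n : ℕ} {q : F} (hq : q ≠ 0) {x : ℤ → F}
    (hx : Set.InjOn x (I n)) (hx0 : ∀ a, x a ≠ 0) (hxn : ∀ a, x (-a) = (x a)⁻¹) :
    ∃ Q : F[X], (∀ a ∈ I n, ∏ b ∈ I n \ {a, -a}, (q * x a - q⁻¹ * x b) / (x a - x b) =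
        Q.eval (x a) * (x a - (x a)⁻¹) / ∏ b ∈ (I n).erase a, (x a - x b)) ∧
      (X ^ 2 * Q).natDegree ≤ 2 * n ∧
      (X ^ 2 * Q).coeff (2 * n) = ∑ i ∈ Finset.range n, (q ^ 2) ^ i ∧
      q ^ 2 * (X ^ 3 * Q).coeff (2 * n) =
        -(∑ a ∈ I n, x a) * (∑ i ∈ Finset.range n, (q ^ 2) ^ i - 1) ∧
      Q.coeff 0 = ∑ i ∈ Finset.range n, ((q ^ 2)⁻¹) ^ i := by
  obtain ⟨Q, h0, h⟩ := exists_interpolating_poly (q ^ 2) (q ^ 2)⁻¹ (fun j : ℤ => x j + x (-j))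
    (Finset.Icc (1 : ℤ) n)
  rw [Int.card_Icc, show ((n : ℤ) + 1 - 1).toNat = n by simp, ← sum_I] at h
  refine ⟨Q, fun a ha => ?_, h⟩
  have ha' := mem_I.1 ha
  -- x_a and x_{-a} are the two roots of the same quadratic X² - y_{|a|} X + 1, so Q serves both
  -- signs.
  have hy : x |a| + x (-|a|) = x a + (x a)⁻¹ := by
    rcases abs_choice a with h | h <;> rw [h, hxn]
    rw [neg_neg, add_comm]
  have habs := abs_cases a
  rw [h0 |a| (Finset.mem_Icc.2 (by omega)) (x a) (by
    have := hx0 a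
    simp only [hy]
    field_simp
    ring), Finset.prod_div_distrib, prod_I_sdiff]
  have hmem : -a ∈ (I n).erase a := by
    rw [Finset.mem_erase, mem_I]
    omega
  have hne := sub_inv_ne_zero_of_injOn hx hxn ha
  have hset : ((I n).erase a).erase (-a) = I n \ {a, -a} := by
    ext b
    simp only [Finset.mem_erase, Finset.mem_sdiff, Finset.mem_insert, Finset.mem_singleton]
    tauto
  -- The factor b = -a of the full denominator is x_a - x_a⁻¹.
  rw [← Finset.mul_prod_erase _ _ hmem, hset, hxn, mul_comm (x a - (x a)⁻¹),
    mul_div_mul_right _ _ hne]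
  congr 1
  refine Finset.prod_congr rfl fun j _ => ?_
  have := hx0 j
  rw [hxn]
  field_simp
  ring

open Polynomial in
-- The parameters α, β, γ cover the three types at once. The term in β drops out because XQ has
-- neither a constant term nor a term of degree 2n.
theorem casimir_sum_zero {F : Type*} [Field F] {n : ℕ} (hn : 0 < n) {q : F} (hq : q ≠ 0)
    {x : ℤ → F} (hx : Set.InjOn x (I n)) (hx0 : ∀ a, x a ≠ 0) (hxn : ∀ a, x (-a) = (x a)⁻¹)
    (α β γ : F) :
    ∑ a ∈ I n, (α * x a + β + γ * (x a)⁻¹) / (x a - (x a)⁻¹) *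
        ∏ b ∈ I n \ {a, -a}, (q * x a - q⁻¹ * x b) / (x a - x b) =
      ∑ i ∈ Finset.range n, (α * q ^ (2 * i) - γ * (q⁻¹) ^ (2 * i)) := by
  obtain ⟨Q, h0, h1, h2, -, h4⟩ := exists_poly_eval_eq_prod hq hx hx0 hxn
  obtain ⟨m, hm⟩ : ∃ m, 2 * n = m + 1 := ⟨2 * n - 1, by omega⟩
  rw [hm] at h1 h2
  have zz : ∀ k, m + 1 < k + 2 → Q.coeff k = 0 := by
    intro k hk
    rw [← coeff_X_pow_mul Q 2 k]
    exact coeff_eq_zero_of_natDegree_lt (lt_of_le_of_lt h1 hk)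
  have hx1 : ∏ a ∈ I n, -x a = 1 := by
    rw [prod_I]
    exact Finset.prod_eq_one fun j _ => by rw [hxn, neg_mul_neg, mul_inv_cancel₀ (hx0 j)]
  have key := sum_eval_mul_inv_div_eq_coeff_sub hx (fun a _ => hx0 a) hx1
    (p := C α * (X ^ 2 * Q) + C β * (X * Q) + C γ * Q) ((card_I n).trans hm) (by
      refine natDegree_le_iff_coeff_eq_zero.2 fun k hk => ?_
      obtain ⟨l, rfl⟩ : ∃ l, k = l + 1 := ⟨k - 1, by omega⟩
      rw [coeff_add, coeff_add, coeff_C_mul, coeff_C_mul, coeff_C_mul, coeff_X_mul,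
        zz _ (by omega), zz _ (by omega), coeff_eq_zero_of_natDegree_lt (lt_of_le_of_lt h1 hk)]
      ring)
  have e : ∀ a ∈ I n, (α * x a + β + γ * (x a)⁻¹) / (x a - (x a)⁻¹) *
      ∏ b ∈ I n \ {a, -a}, (q * x a - q⁻¹ * x b) / (x a - x b) =
      (C α * (X ^ 2 * Q) + C β * (X * Q) + C γ * Q).eval (x a) * (x a)⁻¹ /
        ∏ b ∈ (I n).erase a, (x a - x b) := by
    intro a ha
    have hne := sub_inv_ne_zero_of_injOn hx hxn ha
    rw [h0 a ha, ← mul_div_assoc, mul_comm (Q.eval _), ← mul_assoc, div_mul_cancel₀ _ hne]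
    congr 1
    simp only [eval_add, eval_mul, eval_C, eval_pow, eval_X]
    have := hx0 a
    field_simp
  rw [Finset.sum_congr rfl e, key]
  simp only [coeff_add, coeff_C_mul, coeff_X_mul, h2, h4, mul_coeff_zero, coeff_X_zero,
    zz _ (show m + 1 < m + 2 by omega), zz _ (show m + 1 < m + 1 + 2 by omega), coeff_X_pow,
    Finset.sum_sub_distrib, ← Finset.mul_sum, pow_mul, inv_pow]
  simp

open Polynomial in
theorem casimir_sum_one {F : Type*} [Field F] {n : ℕ} (hn : 0 < n) {q : F} (hq : q ≠ 0)
    {x : ℤ → F} (hx : Set.InjOn x (I n)) (hx0 : ∀ a, x a ≠ 0) (hxn : ∀ a, x (-a) = (x a)⁻¹)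
    (α β γ : F) :
    ∑ a ∈ I n, (α * x a + β + γ * (x a)⁻¹) / (x a - (x a)⁻¹) * x a *
        ∏ b ∈ I n \ {a, -a}, (q * x a - q⁻¹ * x b) / (x a - x b) =
      α * q ^ (2 * (n - 1)) * ∑ a ∈ I n, x a + β * ∑ i ∈ Finset.range n, q ^ (2 * i) := by
  obtain ⟨Q, h0, h1, h2, h3, -⟩ := exists_poly_eval_eq_prod hq hx hx0 hxn
  obtain ⟨m, hm⟩ : ∃ m, 2 * n = m + 1 := ⟨2 * n - 1, by omega⟩
  rw [hm] at h1 h2 h3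
  have zz : ∀ k, m + 1 < k + 2 → Q.coeff k = 0 := by
    intro k hk
    rw [← coeff_X_pow_mul Q 2 k]
    exact coeff_eq_zero_of_natDegree_lt (lt_of_le_of_lt h1 hk)
  have key := sum_eval_div_eq_coeff_add hx
    (p := C α * (X ^ 2 * Q) + C β * (X * Q) + C γ * Q) ((card_I n).trans hm) (by
      refine natDegree_le_iff_coeff_eq_zero.2 fun k hk => ?_
      obtain ⟨l, rfl⟩ : ∃ l, k = l + 1 := ⟨k - 1, by omega⟩
      rw [coeff_add, coeff_add, coeff_C_mul, coeff_C_mul, coeff_C_mul, coeff_X_mul,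
        zz _ (by omega), zz _ (by omega), coeff_eq_zero_of_natDegree_lt (lt_of_le_of_lt h1 hk)]
      ring)
  have e : ∀ a ∈ I n, (α * x a + β + γ * (x a)⁻¹) / (x a - (x a)⁻¹) * x a *
      ∏ b ∈ I n \ {a, -a}, (q * x a - q⁻¹ * x b) / (x a - x b) =
      (C α * (X ^ 2 * Q) + C β * (X * Q) + C γ * Q).eval (x a) /
        ∏ b ∈ (I n).erase a, (x a - x b) := by
    intro a ha
    have hne := sub_inv_ne_zero_of_injOn hx hxn ha
    rw [h0 a ha, mul_right_comm, ← mul_div_assoc, mul_comm (Q.eval _), ← mul_assoc,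
      div_mul_cancel₀ _ hne, div_mul_eq_mul_div]
    congr 1
    simp only [eval_add, eval_mul, eval_C, eval_pow, eval_X]
    have := hx0 a
    field_simp
  rw [Finset.sum_congr rfl e, key]
  have c1 : (X ^ 2 * Q).coeff m = (X ^ 3 * Q).coeff (m + 1) := by
    rw [pow_succ' X 2, mul_assoc, coeff_X_mul]
  have c2 : (X * Q).coeff m = (X ^ 2 * Q).coeff (m + 1) := by
    rw [pow_two, mul_assoc, coeff_X_mul]
  obtain ⟨k, rfl⟩ : ∃ k, n = k + 1 := ⟨n - 1, by omega⟩
  -- With S = ∑_{i<n} q^{2i}, the two recursions give q^{2n} + S = q² S + 1, so the coefficient q² S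
  -- - (S - 1) of α ∑ x_a is q^{2n}.
  have gs := geom_sum_succ (x := q ^ 2) (n := k + 1)
  rw [geom_sum_succ'] at gs
  apply mul_left_cancel₀ (pow_ne_zero 2 hq)
  simp only [coeff_add, coeff_C_mul, coeff_X_mul, c1, c2, h2, Nat.add_sub_cancel, pow_mul,
    zz _ (show m + 1 < m + 2 by omega), zz _ (show m + 1 < m + 1 + 2 by omega)]
  linear_combination α * h3 - α * (∑ a ∈ I (k + 1), x a) * gs

/-! ### The weight 2ρ and the elements L_a -/

/-- The coefficient of `ε_n` in `2ρ`. -/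
def ClassicalType.shift : ClassicalType → ℤ
  | .B => 1
  | .C => 2
  | .D => 0

theorem eps_natCast_apply {n i : ℕ} (hi : 1 ≤ i) (k : Fin n) :
    eps n i k = if i = k + 1 then 1 else 0 := by
  unfold eps
  have h1 : ((i : ℤ) = (k : ℤ) + 1) ↔ i = k + 1 := by omega
  have h2 : ¬ ((i : ℤ) = -((k : ℤ) + 1)) := by omega
  simp only [h1, if_neg h2]

theorem eps_neg (n : ℕ) (a : ℤ) : eps n (-a) = -eps n a := by
  funext k
  simp only [eps, Pi.neg_apply]
  split_ifs <;> first | omega | simp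

theorem two_rho_apply (X : ClassicalType) (n : ℕ) (k : Fin n) :
    ((2 : ℚ) • rho X n) k = ((2 * ((n : ℤ) - 1 - k) + X.shift : ℤ) : ℚ) := by
  have h : ∀ c : ℕ → ℚ, ∑ i ∈ Finset.Icc 1 n, c i * eps n i k = c (k + 1) := by
    intro c
    rw [Finset.sum_eq_single_of_mem (k + 1 : ℕ) (Finset.mem_Icc.2 (by omega))]
    · rw [eps_natCast_apply (by omega)]
      simp
    · intro i hi hne
      rw [eps_natCast_apply (Finset.mem_Icc.1 hi).1, if_neg hne, mul_zero]
  have h1 : (∑ i ∈ Finset.Icc 1 n, ∑ j ∈ Finset.Ioc i n,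
      ((eps n i - eps n j) + (eps n i + eps n j))) k = 2 * ((n : ℚ) - 1 - k) := by
    have := h (fun i => 2 * ((n - i : ℕ) : ℚ))
    rw [show 2 * ((n : ℚ) - 1 - k) = 2 * ((n - (k + 1) : ℕ) : ℚ) by
      rw [Nat.cast_sub (by omega)]; push_cast; ring, ← this, Finset.sum_apply]
    refine Finset.sum_congr rfl fun i _ => ?_
    simp only [Finset.sum_apply, Pi.add_apply, Pi.sub_apply]
    -- The ε_j cancel within each pair of roots, leaving 2ε_i for each of the n - i values of j.
    rw [Finset.sum_congr rfl fun (j : ℕ) _ => show eps n i k - eps n j k + (eps n i k + eps n j k) =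
      2 * eps n i k by ring, Finset.sum_const, Nat.card_Ioc, nsmul_eq_mul]
    ring
  have h2 := h fun _ => 1
  have h3 := h fun _ => 2
  unfold rho
  cases X <;>
    simp only [Pi.smul_apply, Pi.add_apply, h1, smul_eq_mul, ClassicalType.shift,
      Finset.sum_apply, Pi.zero_apply, h3] <;>
    push_cast
  · simp only [one_mul] at h2
    rw [h2]
    ring
  · ring
  · ring

theorem exists_int_eps_dot_two_rho (X : ClassicalType) (n : ℕ) (a : ℤ) :
    ∃ d : ℤ, eps n a ⬝ᵥ (2 : ℚ) • rho X n = d := by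
  choose e he using eps_int n a
  refine ⟨∑ k, e k * (2 * ((n : ℤ) - 1 - (k : Fin n)) + X.shift), ?_⟩
  simp only [dotProduct, two_rho_apply, he]
  push_cast
  rfl

theorem q_ne_zero (X : ClassicalType) (n : ℕ) : q X n ≠ 0 :=
  pow_ne_zero _ RatFunc.X_ne_zero

theorem qPow_ne_zero (X : ClassicalType) (n : ℕ) (y : ℚ) : qPow X n y ≠ 0 :=
  zpow_ne_zero _ RatFunc.X_ne_zero

/-- The floor is exact on integer exponents, and every pairing (ε_a, 2ρ) is an integer; hence the
actual value of m_o plays no role. -/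
theorem qPow_intCast (X : ClassicalType) (n : ℕ) (z : ℤ) : qPow X n z = q X n ^ z := by
  have h : ⌊(z : ℚ) * (mo X n : ℚ)⌋ = (mo X n : ℤ) * z := by
    rw [← Int.floor_intCast (R := ℚ) ((mo X n : ℤ) * z)]
    congr 1
    push_cast
    ring
  rw [qPow, q, h, zpow_mul, zpow_natCast]

theorem L_mul_L_neg (X : ClassicalType) (n : ℕ) (a : ℤ) : L X n a * L X n (-a) = 1 := by
  obtain ⟨d, hd⟩ := exists_int_eps_dot_two_rho X n a
  have he : (2 • epsP X n a) + (2 • epsP X n (-a)) = 0 := by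
    rw [← smul_add, show epsP X n a + epsP X n (-a) = 0 from Subtype.ext (by
      simp [epsP, eps_neg]), smul_zero]
  have hd' : eps n (-a) ⬝ᵥ (2 : ℚ) • rho X n = ((-d : ℤ) : ℚ) := by
    rw [eps_neg, neg_dotProduct, hd]
    push_cast
    rfl
  rw [L, L, hd, hd', qPow_intCast, qPow_intCast, smul_mul_smul_comm, ← zpow_add₀ (q_ne_zero X n),
    add_neg_cancel, zpow_zero, one_smul, Kel, Kel, AddMonoidAlgebra.single_mul_single, he, mul_one,
    AddMonoidAlgebra.one_def]

theorem eps_zero (n : ℕ) : eps n 0 = 0 := by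
  funext k
  have h1 : ¬ ((0 : ℤ) = (k : ℤ) + 1) := by omega
  have h2 : ¬ ((0 : ℤ) = -((k : ℤ) + 1)) := by omega
  simp only [eps, if_neg h1, if_neg h2, Pi.zero_apply]

theorem qPow_zero (X : ClassicalType) (n : ℕ) : qPow X n 0 = 1 := by
  simp [qPow]

theorem sub_inv_mul_sum_pow {F : Type*} [Field F] {q : F} (hq : q ≠ 0) (m : ℕ) :
    (q - q⁻¹) * ∑ i ∈ Finset.range (m + 1), q ^ (2 * i) = q ^ (2 * m + 1) - q⁻¹ := by
  induction m with
  | zero => simp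
  | succ m ih =>
    rw [Finset.sum_range_succ, mul_add, ih]
    field_simp
    ring

theorem L_zero (X : ClassicalType) (n : ℕ) : L X n 0 = 1 := by
  have he := eps_zero n
  have he' : epsP X n 0 = 0 := Subtype.ext he
  rw [L, he, he', zero_dotProduct, ← Int.cast_zero, qPow_intCast, zpow_zero, one_smul, smul_zero,
    Kel, AddMonoidAlgebra.one_def]

theorem eps_injOn (n : ℕ) : Set.InjOn (eps n) (I n) := by
  have h : ∀ a b : ℤ, a ∈ I n → eps n a = eps n b → a = b := by
    intro a b ha hab
    have ha := mem_I.1 ha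
    have := congrFun hab ⟨a.natAbs - 1, by omega⟩
    simp only [eps] at this
    split_ifs at this <;> first | omega | norm_num at this
  intro a ha b _ hab
  exact h a b ha hab

/-- Distinctness comes from the basis elements K_{2ε_a} alone: the scalars q^{(ε_a, 2ρ)} only need
to be nonzero. This makes all the denominators nonzero. -/
theorem Lf_injOn (X : ClassicalType) (n : ℕ) : Set.InjOn (Lf X n) (I n) := by
  intro a ha b hb hab
  have h := IsFractionRing.injective (U0 X n) (FracU0 X n) hab
  simp only [L, Kel, AddMonoidAlgebra.smul_single, smul_eq_mul, mul_one] at h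
  have h2 : 2 • epsP X n a = 2 • epsP X n b := by
    rcases (Finsupp.single_eq_single_iff _ _ _ _).1 (congrArg AddMonoidAlgebra.coeff h) with h | h
    · exact h.1
    · exact absurd h.1 (qPow_ne_zero X n _)
  have h3 : (2 : ℕ) • eps n a = 2 • eps n b := congrArg Subtype.val h2
  refine eps_injOn n ha hb ?_
  funext k
  have := congrFun h3 k
  simpa using this

theorem Lf_neg (X : ClassicalType) (n : ℕ) (a : ℤ) : Lf X n (-a) = (Lf X n a)⁻¹ := by
  refine eq_inv_of_mul_eq_one_right ?_
  rw [Lf, Lf, ← map_mul, L_mul_L_neg, map_one]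

theorem Lf_ne_zero (X : ClassicalType) (n : ℕ) (a : ℤ) : Lf X n a ≠ 0 := by
  refine left_ne_zero_of_mul_eq_one (b := Lf X n (-a)) ?_
  rw [Lf, Lf, ← map_mul, L_mul_L_neg, map_one]

theorem qf_ne_zero (X : ClassicalType) (n : ℕ) : qf X n ≠ 0 := by
  rw [qf, Ne, map_eq_zero]
  exact q_ne_zero X n

theorem sum_qPow_two_rho (X : ClassicalType) (n : ℕ) :
    algebraMap 𝕂 (FracU0 X n)
        (∑ a ∈ I n, qPow X n (((2 : ℚ) • rho X n) ⬝ᵥ eps n a)) =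
      ∑ i ∈ Finset.range n,
        (qf X n ^ X.shift * qf X n ^ (2 * i) + qf X n ^ (-X.shift) * (qf X n)⁻¹ ^ (2 * i)) := by
  have hq := qf_ne_zero X n
  rw [sum_I, map_sum]
  -- Put i = n - j: then (2ρ, ε_{±j}) = ±(2i + shift).
  refine Finset.sum_bij' (fun j _ => n - j.toNat) (fun i _ => (n : ℤ) - i) ?_ ?_ ?_ ?_ ?_
  · intro j hj
    have := Finset.mem_Icc.1 hj
    exact Finset.mem_range.2 (by omega)
  · intro i hi
    have := Finset.mem_range.1 hi
    exact Finset.mem_Icc.2 (by omega)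
  · intro j hj
    have := Finset.mem_Icc.1 hj
    omega
  · intro i hi
    have := Finset.mem_range.1 hi
    omega
  · intro j hj
    have hj := Finset.mem_Icc.1 hj
    obtain ⟨b, rfl⟩ := Int.eq_ofNat_of_zero_le (show 0 ≤ j by omega)
    obtain ⟨i, hi⟩ : ∃ i, n - b = i := ⟨_, rfl⟩
    have h : ((2 : ℚ) • rho X n) ⬝ᵥ eps n b = ((2 * (i : ℤ) + X.shift : ℤ) : ℚ) := by
      rw [dot_eps _ b (by omega) (by omega), two_rho_apply]
      congr 2
      simp only
      omega
    have h' : ((2 : ℚ) • rho X n) ⬝ᵥ eps n (-(b : ℤ)) = ((-(2 * (i : ℤ) + X.shift) : ℤ) : ℚ) := by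
      rw [eps_neg, dotProduct_neg, h]
      push_cast
      rfl
    rw [h, h', qPow_intCast, qPow_intCast, RingHom.map_add, map_zpow₀, map_zpow₀, ← qf, Int.toNat_natCast,
      hi, ← zpow_natCast, ← zpow_natCast, inv_zpow', ← zpow_add₀ hq, ← zpow_add₀ hq]
    congr 2 <;> push_cast <;> ring

/-! ### Specialisation of α, β, γ to the three types -/

theorem G_B_eq (n k : ℕ) : G .B n k = (qf .B n ^ k)⁻¹ + ∑ a ∈ I n,
    (qf .B n * Lf .B n a + (qf .B n - (qf .B n)⁻¹) + -(qf .B n)⁻¹ * (Lf .B n a)⁻¹) /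
      (Lf .B n a - (Lf .B n a)⁻¹) * Lf .B n a ^ k * Pna .B n a := by
  simp only [G]
  congr! 5
  ring

theorem G_C_eq (n k : ℕ) : G .C n k = ∑ a ∈ I n,
    (qf .C n ^ 2 * Lf .C n a + 0 + -(qf .C n ^ 2)⁻¹ * (Lf .C n a)⁻¹) /
      (Lf .C n a - (Lf .C n a)⁻¹) * Lf .C n a ^ k * Pna .C n a := by
  simp only [G]
  congr! 4
  ring

/-- Type D has no fraction in x_a - x_a⁻¹; it fits the common shape after inserting that quantity
divided by itself. -/
theorem G_D_eq (n k : ℕ) : G .D n k = ∑ a ∈ I n,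
    (1 * Lf .D n a + 0 + -1 * (Lf .D n a)⁻¹) /
      (Lf .D n a - (Lf .D n a)⁻¹) * Lf .D n a ^ k * Pna .D n a := by
  simp only [G]
  refine Finset.sum_congr rfl fun a ha => ?_
  have hne := sub_inv_ne_zero_of_injOn (Lf_injOn .D n) (Lf_neg .D n) ha
  rw [show 1 * Lf .D n a + 0 + -1 * (Lf .D n a)⁻¹ = Lf .D n a - (Lf .D n a)⁻¹ by ring,
    div_self hne, one_mul]

end QuantumCasimir

theorem proposition3p4 (X : QuantumCasimir.ClassicalType) (n : ℕ) (hn : X.minRank ≤ n) :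
    QuantumCasimir.G X n 0 =
        algebraMap QuantumCasimir.𝕂 (QuantumCasimir.FracU0 X n)
          (∑ a ∈ QuantumCasimir.I' X n,
            QuantumCasimir.qPow X n
              (((2 : ℚ) • QuantumCasimir.rho X n) ⬝ᵥ QuantumCasimir.eps n a)) ∧
      QuantumCasimir.G X n 1 =
        algebraMap QuantumCasimir.𝕂 (QuantumCasimir.FracU0 X n)
            (QuantumCasimir.q X n ^ (QuantumCasimir.c X n - 1)) *
          algebraMap (QuantumCasimir.U0 X n) (QuantumCasimir.FracU0 X n)
            (∑ a ∈ QuantumCasimir.I' X n, QuantumCasimir.L X n a) := by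
  have hn0 : 0 < n := lt_of_lt_of_le (by cases X <;> simp [QuantumCasimir.ClassicalType.minRank]) hn
  have hq := QuantumCasimir.qf_ne_zero X n
  have zero := QuantumCasimir.casimir_sum_zero hn0 hq (QuantumCasimir.Lf_injOn X n)
    (QuantumCasimir.Lf_ne_zero X n) (QuantumCasimir.Lf_neg X n)
  have one := QuantumCasimir.casimir_sum_one hn0 hq (QuantumCasimir.Lf_injOn X n)
    (QuantumCasimir.Lf_ne_zero X n) (QuantumCasimir.Lf_neg X n)
  have rhs := QuantumCasimir.sum_qPow_two_rho X n
  have hLs : algebraMap (QuantumCasimir.U0 X n) (QuantumCasimir.FracU0 X n)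
      (∑ a ∈ QuantumCasimir.I n, QuantumCasimir.L X n a) =
      ∑ a ∈ QuantumCasimir.I n, QuantumCasimir.Lf X n a := map_sum _ _ _
  have h0I : (0 : ℤ) ∉ QuantumCasimir.I n := by simp [QuantumCasimir.I]
  obtain ⟨m, rfl⟩ : ∃ m, n = m + 1 := ⟨n - 1, by omega⟩
  rw [map_zpow₀, ← QuantumCasimir.qf]
  cases X with
  | B =>
    simp only [QuantumCasimir.G_B_eq, QuantumCasimir.I', QuantumCasimir.c, pow_zero, mul_one,
      pow_one, Finset.sum_insert h0I, RingHom.map_add, rhs, hLs, QuantumCasimir.L_zero,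
      RingHom.map_one, QuantumCasimir.eps_zero, dotProduct_zero, QuantumCasimir.qPow_zero,
      QuantumCasimir.Pna, zero, one, QuantumCasimir.sub_inv_mul_sum_pow hq, inv_one,
      QuantumCasimir.ClassicalType.shift, zpow_one, zpow_neg, Nat.add_sub_cancel]
    refine ⟨by simp only [neg_mul, sub_neg_eq_add], ?_⟩
    -- The middle term has telescoped to q^{2m+1} - q⁻¹: its q⁻¹ cancels the initial summand of G,
    -- and its q^{2m+1} is the contribution of L_0 = 1.
    rw [show (2 * ((m + 1 : ℕ) : ℤ) - 1) = ((2 * m + 1 : ℕ) : ℤ) by push_cast; ring, zpow_natCast]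
    ring
  | C =>
    simp only [QuantumCasimir.G_C_eq, QuantumCasimir.I', QuantumCasimir.c, pow_zero, mul_one,
      pow_one, rhs, hLs, QuantumCasimir.Pna, zero, one, QuantumCasimir.ClassicalType.shift,
      zpow_neg, Nat.add_sub_cancel, zpow_ofNat]
    refine ⟨by simp only [neg_mul, sub_neg_eq_add], ?_⟩
    rw [show (2 * ((m + 1 : ℕ) : ℤ) + 1 - 1) = ((2 * m + 2 : ℕ) : ℤ) by push_cast; ring,
      zpow_natCast]
    ring
  | D =>
    simp only [QuantumCasimir.G_D_eq, QuantumCasimir.I', QuantumCasimir.c, pow_zero, mul_one,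
      pow_one, rhs, hLs, QuantumCasimir.Pna, zero, one, QuantumCasimir.ClassicalType.shift,
      neg_zero, zpow_zero, Nat.add_sub_cancel]
    refine ⟨by simp only [neg_mul, sub_neg_eq_add], ?_⟩
    rw [show (2 * ((m + 1 : ℕ) : ℤ) - 1 - 1) = ((2 * m : ℕ) : ℤ) by push_cast; ring,
      zpow_natCast]
    ring
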